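/- Let $(A,\mathfrak m)$ be a Noetherian local ring with infinite residue field, $M$ a finitely generated $A$-module with $\dim M>0$, and $I_1,\ldots,I_s$ ($s\ge 1$) ideals of $A$. An element $x\in A$ is called a *Rees's superficial element* of $(I_1,\ldots,I_s)$ with respect to a finitely generated module $N$ if there is an $i$ with $x\in I_i$ and an integer $c$ such that $$xN\cap I_1^{n_1}\cdots I_i^{n_i+1}\cdots I_s^{n_s}N = x\,I_1^{n_1}\cdots I_i^{n_i}\cdots I_s^{n_s}N$$ for all $n_i\ge c$ and all $n_j\ge 0$ ($j\ne i$). A sequence $x_1,\ldots,x_t$ is a *Rees's superficial sequence* of $(I_1,\ldots,I_s)$ with respect to $M$ if, for each $0\le i<t$, $x_{i+1}$ is a Rees's superficial element of $(I_1,\ldots,I_s)$ with respect to $M/(x_1,\ldots,x_i)M$. A finite set $\mathfrak R\subseteq I_1\cup\cdots\cup I_s$ is a *joint reduction* of $(I_1,\ldots,I_s)$ with respect to $M$ if $$I_1^{n_1+1}\cdots I_s^{n_s+1}M=\sum_{i=1}^s(\mathfrak R\cap I_i)\,I_1^{n_1+1}\cdots I_i^{n_i}\cdots I_s^{n_s+1}M$$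 for all large $n_1,\ldots,n_s$, where $(\emptyset)=0$. A *system of parameters* for $M$ is a sequence of $\dim M$ elements of $\mathfrak m$ such that $M$ modulo the submodule they generate, $M/(x_1,\ldots,x_{\dim M})M$, has finite length. (i) Assume that $I_1,\ldots,I_s$ are proper ideals, and let $$h=\max\Big\{\mathrm{ht}\Big(\frac{I_j+\mathrm{Ann}_AM}{\mathrm{Ann}_AM}\Big)\ \Big|\ j=1,\ldots,s\Big\}.$$ Then $h$ is finite, and there exists a Rees's superficial sequence $x_1,\ldots,x_h$ of $(I_1,\ldots,I_s)$ with respect to $M$ which is part of a system of parameters for $M$. (ii) If $y_1,\ldots,y_m$ is a Rees's superficial sequence of $(I_1,\ldots,I_s)$ with respect to $M$ and $$I_1\cdots I_s\subseteq\sqrt{(y_1,\ldots,y_m)+\mathrm{Ann}_AM},$$ then $\{y_1,\ldots,y_m\}$ is a joint reduction of $(I_1,\ldots,I_s)$ with respect to $M$. In particular, if $I_1,\ldots,I_s$ are proper and $y_1,\ldots,y_m$ is moreover a system of parameters for $M$, then the displayed inclusion holds and $\{y_1,\ldots,y_m\}$ is a joint reduction of $(I_1,\ldots,I_s)$ with respect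 to $M$. -/

import Mathlib

section ReesSuperficial

variable {A : Type*} [CommRing A] {s : ℕ}

/-- The product of powers `I₁ ^ n₁ ⋯ I_s ^ n_s`. -/
def idealMonomial (I : Fin s → Ideal A) (n : Fin s → ℕ) : Ideal A :=
  ∏ j, I j ^ n j

/-- `x` is a Rees superficial element of `(I₁, …, I_s)` with respect to `M`: for some `i` with
`x ∈ I_i`, the equality
`xM ∩ I₁^{n₁} ⋯ I_i^{n_i + 1} ⋯ I_s^{n_s} M = x I₁^{n₁} ⋯ I_i^{n_i} ⋯ I_s^{n_s} M`
holds for all sufficiently large `n_i` and all `n_j ≥ 0`, `j ≠ i` (the bound on `n_i` does not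
depend on the other exponents). -/
def IsReesSuperficialElement (I : Fin s → Ideal A) (M : Type*) [AddCommGroup M] [Module A M]
    (x : A) : Prop :=
  ∃ i : Fin s, x ∈ I i ∧ ∃ N : ℕ, ∀ n : Fin s → ℕ, N ≤ n i →
    (Ideal.span {x} • (⊤ : Submodule A M)) ⊓
        (idealMonomial I (Function.update n i (n i + 1)) • (⊤ : Submodule A M)) =
      Ideal.span {x} • (idealMonomial I n • (⊤ : Submodule A M))

/-- `x₁, …, x_t` is a Rees superficial sequence of `(I₁, …, I_s)` with respect to `M`: for
`i = 0, …, t - 1` the element `x_{i+1}` is a Rees superficial element of `(I₁, …, I_s)` with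
respect to `M / (x₁, …, x_i) M`. -/
def IsReesSuperficialSequence (I : Fin s → Ideal A) (M : Type*) [AddCommGroup M] [Module A M]
    (xs : List A) : Prop :=
  ∀ (i : ℕ) (h : i < xs.length),
    IsReesSuperficialElement I
      (M ⧸ (Ideal.ofList (xs.take i) • ⊤ : Submodule A M)) xs[i]

/-- The finite set `R ⊆ I₁ ∪ ⋯ ∪ I_s` is a joint reduction of `(I₁, …, I_s)` with respect to `M`
(of some type): with `R_i = R ∩ I_i`,
`I₁^{n₁+1} ⋯ I_s^{n_s+1} M = ∑ i, (R_i) I₁^{n₁+1} ⋯ I_i^{n_i} ⋯ I_s^{n_s+1} M`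
for all large `n₁, …, n_s`. -/
def IsJointReduction (I : Fin s → Ideal A) (M : Type*) [AddCommGroup M] [Module A M]
    (R : Set A) : Prop :=
  R.Finite ∧ (∀ x ∈ R, ∃ i, x ∈ I i) ∧
    ∃ N : ℕ, ∀ n : Fin s → ℕ, (∀ j, N ≤ n j) →
      idealMonomial I (fun j => n j + 1) • (⊤ : Submodule A M) =
        ⨆ i : Fin s, Ideal.span (R ∩ (I i : Set A)) •
          (idealMonomial I (Function.update (fun j => n j + 1) i (n i)) • (⊤ : Submodule A M))

/-- `x₁, …, x_d` is a system of parameters for the module `M` over the local ring `A`: the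
elements lie in the maximal ideal, `d = dim M`, and `M / (x₁, …, x_d) M` has finite length. -/
def IsSystemOfParameters [IsLocalRing A] (M : Type*) [AddCommGroup M] [Module A M]
    (xs : List A) : Prop :=
  (∀ x ∈ xs, x ∈ IsLocalRing.maximalIdeal A) ∧
    Module.supportDim A M = ((xs.length : ℕ∞) : WithBot ℕ∞) ∧
    IsFiniteLength A (M ⧸ (Ideal.ofList xs • ⊤ : Submodule A M))

/-- `x₁, …, x_t` is part of a system of parameters for `M`. -/
def IsPartOfSystemOfParameters [IsLocalRing A] (M : Type*) [AddCommGroup M] [Module A M]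
    (xs : List A) : Prop :=
  ∃ zs : List A, IsSystemOfParameters M (xs ++ zs)

end ReesSuperficial

/-!
The existence of superficial elements rests on the multi-Rees algebra `R = ⨁ₙ I₁ ^ n₁ ⋯ I_s ^ n_s tⁿ`
and the finite module `⨁ₙ I₁ ^ n₁ ⋯ I_s ^ n_s M tⁿ` over this Noetherian ring, realized inside
`A[t₁, …, t_s] ⊗ M`. Since the residue field is infinite, there is `x ∈ I_i` such that `x t_i` lies in
no associated prime of the quotients `⨁ₙ I₁ ^ n₁ ⋯ I_s ^ n_s M / I₁ ^ n₁ ⋯ I_j ^ (n_j + 1) ⋯ I_s ^ n_s M`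
(`j = 1, …, s`), other than those containing `I_i t_i`. Its kernel on these quotients is then killed
by a power of `I_i t_i`, and as graded submodules are generated in bounded degrees
(`exists_forall_pow_smul_eq_of_le_idealMonomial_smul`) the kernel vanishes in the degrees with `n_i`
large. Together with an Artin–Rees argument for `xM` this makes `x` superficial, with a bound on
`n_i` that does not depend on the other exponents (`exists_isReesSuperficialElement`).

The element `x` can also be chosen outside the minimal primes of `N = M / (x₁, …, x_t) M` that do not
contain `I_i`. If `I_i` has height `h > t` modulo `Ann M` and `dim N = dim M - t`, then a minimal
prime of `N` of maximal coheight cannot contain `I_i`, because height and coheight add up to at most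
`dim M`. Hence `dim N / xN = dim N - 1`, and `h` superficial elements in an ideal `I_i` of largest
height extend to a system of parameters.

For a superficial sequence `y₁, …, y_m`, the superficiality of the successive elements gives
`(y₁, …, y_m) M ∩ Iⁿ M ⊆ ∑ y_k I^(n - e) M` for large `n`, where `e` is the unit vector of the ideal
that contains `y_k` (`IsReesSuperficialSequence.exists_ofList_smul_inf_le`). The radical condition
puts `Iⁿ M` into `(y₁, …, y_m) M`, and the result is the joint reduction equality.
-/

open TensorProduct
open scoped Pointwise

/-! ### Avoidance of submodules and associated primes -/

/-- Over a local ring with infinite residue field, no module is a finite union of proper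
submodules. -/
theorem exists_forall_notMem_of_infinite_residueField {A : Type*} [CommRing A] [IsLocalRing A]
    [Infinite (IsLocalRing.ResidueField A)] {E : Type*} [AddCommGroup E] [Module A E]
    {𝒰 : Set (Submodule A E)} (hfin : 𝒰.Finite) (htop : ⊤ ∉ 𝒰) :
    ∃ e : E, ∀ U ∈ 𝒰, e ∉ U := by
  induction 𝒰, hfin using Set.Finite.induction_on with
  | empty => exact ⟨0, by simp⟩
  | @insert U 𝒰 _ hfin ih =>
    simp only [Set.mem_insert_iff, not_or] at htop
    obtain ⟨e, he⟩ := ih htop.2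
    by_cases heU : e ∈ U
    swap
    · exact ⟨e, by simpa using ⟨heU, he⟩⟩
    obtain ⟨v, hv⟩ : ∃ v, v ∉ U := by
      by_contra! h
      exact htop.1 (eq_top_iff.2 fun v _ => h v).symm
    let lift : IsLocalRing.ResidueField A → A := Function.surjInv IsLocalRing.residue_surjective
    have hlift : ∀ r, IsLocalRing.residue A (lift r) = r :=
      Function.surjInv_eq IsLocalRing.residue_surjective
    -- Each `W ∈ 𝒰` contains `v + lift r • e` for at most one `r`, since `e ∉ W`.
    have hbad : (⋃ W ∈ 𝒰, {r | v + lift r • e ∈ W}).Finite := by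
      refine hfin.biUnion fun W hW => Set.Subsingleton.finite fun r hr r' hr' => ?_
      by_contra hne
      have hu : IsUnit (lift r - lift r') := by
        rw [← IsLocalRing.residue_ne_zero_iff_isUnit, map_sub, hlift, hlift]
        exact sub_ne_zero.2 hne
      have hmem : (lift r - lift r') • e ∈ W := by
        have := W.sub_mem hr hr'
        rwa [add_sub_add_left_eq_sub, ← sub_smul] at this
      exact he W hW ((W.smul_mem_iff_of_isUnit hu).1 hmem)
    obtain ⟨r, hr⟩ := hbad.exists_notMem
    refine ⟨v + lift r • e, ?_⟩
    rintro W (rfl | hW) h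
    · exact hv ((W.add_mem_iff_left (W.smul_mem _ heU)).1 h)
    · exact hr (Set.mem_biUnion hW h)

/-- If every associated prime of `Q` containing `l` contains `L`, then a power of `L` kills
`K = {q | l q = 0}`: the minimal primes over `Ann K` are associated primes of `Q` and contain `l`,
so `L ⊆ √(Ann K)`. -/
theorem exists_pow_smul_eq_zero_of_associatedPrimes {R Q : Type*} [CommRing R] [IsNoetherianRing R]
    [AddCommGroup Q] [Module R Q] [Module.Finite R Q] {l : R} {L : Ideal R}
    (h : ∀ P ∈ associatedPrimes R Q, l ∈ P → L ≤ P) :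
    ∃ k : ℕ, ∀ q : Q, l • q = 0 → ∀ r ∈ L ^ k, r • q = 0 := by
  let K : Submodule R Q := LinearMap.ker (LinearMap.lsmul R Q l)
  have hL : L ≤ (Module.annihilator R K).radical := by
    rw [Ideal.radical_eq_sInf, le_sInf_iff]
    rintro P ⟨hP, hPp⟩
    obtain ⟨P', hP', hle⟩ := Ideal.exists_minimalPrimes_le hP
    refine le_trans ?_ hle
    have hass := Module.associatedPrimes.minimalPrimes_annihilator_subset_associatedPrimes R K hP'
    refine h P' (hass.map_of_injective K.subtype K.injective_subtype) (hP'.1.2 ?_)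
    rw [Module.mem_annihilator]
    exact fun q => Subtype.ext q.2
  obtain ⟨k, hk⟩ := Ideal.exists_pow_le_of_le_radical_of_fg hL (IsNoetherian.noetherian L)
  refine ⟨k, fun q hq r hr => ?_⟩
  exact congrArg Subtype.val (Module.mem_annihilator.1 (hk hr) (⟨q, hq⟩ : K))

theorem Submodule.FG.exists_forall_eq_of_monotone {R E : Type*} [Ring R] [IsNoetherianRing R]
    [AddCommGroup E] [Module R E] {N : Submodule R E} (hN : N.FG) {F : ℕ → Submodule R E}
    (hmono : Monotone F) :
    ∃ c, ∀ d, c ≤ d → F c ⊓ N = F d ⊓ N := by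
  have := isNoetherian_of_fg_of_noetherian N hN
  obtain ⟨c, hc⟩ := monotone_stabilizes_iff_noetherian.2 this
    ⟨fun c => (F c).comap N.subtype, fun c d hcd => Submodule.comap_mono (hmono hcd)⟩
  refine ⟨c, fun d hd => le_antisymm (inf_le_inf_right _ (hmono hd)) ?_⟩
  rintro m ⟨hm, hmN⟩
  have : (⟨m, hmN⟩ : N) ∈ (F c).comap N.subtype := (hc d hd).symm.le hm
  exact ⟨this, hmN⟩

/-- The set `Ps` is the set of associated primes of `N / (N ∩ D)`. Stated inside an ambient module
`E`, so that membership in `N` and `D` refers to elements of `E` only. -/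
theorem Submodule.FG.exists_finite_forall_exists_pow_smul_mem {R E : Type*} [CommRing R]
    [IsNoetherianRing R] [AddCommGroup E] [Module R E] {N : Submodule R E} (hN : N.FG)
    (D : Submodule R E) :
    ∃ Ps : Set (Ideal R), Ps.Finite ∧ ∀ (l : R) (L : Ideal R), (∀ P ∈ Ps, l ∈ P → L ≤ P) →
      ∃ k : ℕ, ∀ q ∈ N, l • q ∈ D → ∀ r ∈ L ^ k, r • q ∈ D := by
  have : Module.Finite R N := Module.Finite.iff_fg.2 hN
  refine ⟨associatedPrimes R (N ⧸ D.comap N.subtype), associatedPrimes.finite R _,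
    fun l L h => ?_⟩
  obtain ⟨k, hk⟩ := exists_pow_smul_eq_zero_of_associatedPrimes h
  refine ⟨k, fun q hq hlq r hr => ?_⟩
  have hiff : ∀ r : R, r • (Submodule.Quotient.mk ⟨q, hq⟩ : N ⧸ D.comap N.subtype) = 0 ↔
      r • q ∈ D := fun r => by
    rw [← Submodule.Quotient.mk_smul, Submodule.Quotient.mk_eq_zero]
    rfl
  exact (hiff r).1 (hk _ ((hiff l).2 hlq) r hr)

/-! ### Monomials in the ideals -/

section IdealMonomial

variable {A : Type*} [CommRing A] {s : ℕ} (I : Fin s → Ideal A)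

theorem idealMonomial_add (m n : Fin s → ℕ) :
    idealMonomial I (m + n) = idealMonomial I m * idealMonomial I n := by
  simp [idealMonomial, pow_add, Finset.prod_mul_distrib]

theorem idealMonomial_single (j : Fin s) (k : ℕ) :
    idealMonomial I ⇑(Finsupp.single j k : Fin s →₀ ℕ) = I j ^ k := by
  rw [idealMonomial, Finset.prod_eq_single j (fun b _ hb => by
    rw [Finsupp.single_eq_of_ne hb, pow_zero]) (by simp), Finsupp.single_eq_same]

theorem idealMonomial_antitone {m n : Fin s → ℕ} (h : m ≤ n) :
    idealMonomial I n ≤ idealMonomial I m := by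
  obtain ⟨d, rfl⟩ := le_iff_exists_add.1 h
  rw [idealMonomial_add]
  exact Ideal.mul_le_inf.trans inf_le_left

theorem idealMonomial_update_add_one (n : Fin s → ℕ) (i : Fin s) :
    idealMonomial I (Function.update n i (n i + 1)) = I i * idealMonomial I n := by
  have : Function.update n i (n i + 1) = ⇑(Finsupp.single i 1 : Fin s →₀ ℕ) + n := by
    ext j
    rcases eq_or_ne j i with rfl | hj
    · simp [add_comm]
    · simp [hj]
  rw [this, idealMonomial_add, idealMonomial_single, pow_one]

variable (M : Type*) [AddCommGroup M] [Module A M]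

theorem pow_smul_idealMonomial_smul_top (n : Fin s →₀ ℕ) (j : Fin s) (k : ℕ) :
    I j ^ k • (idealMonomial I ⇑n • (⊤ : Submodule A M)) =
      idealMonomial I ⇑(n + Finsupp.single j k) • (⊤ : Submodule A M) := by
  rw [Finsupp.coe_add, idealMonomial_add, idealMonomial_single, ← Submodule.mul_smul, mul_comm]

theorem smul_idealMonomial_smul_top (n : Fin s →₀ ℕ) (j : Fin s) :
    I j • (idealMonomial I ⇑n • (⊤ : Submodule A M)) =
      idealMonomial I ⇑(n + Finsupp.single j 1 : Fin s →₀ ℕ) • (⊤ : Submodule A M) := by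
  rw [← pow_smul_idealMonomial_smul_top, pow_one]

end IdealMonomial

/-! ### The multi-Rees algebra and the multi-Rees module -/

section MultiRees

variable {A : Type*} [CommRing A] {s : ℕ} (I : Fin s → Ideal A)

/-- The multi-Rees algebra `A[I₁ t₁, …, I_s t_s] = ⨁ₙ I₁ ^ n₁ ⋯ I_s ^ n_s tⁿ`, as the subalgebra of
`A[t₁, …, t_s]` generated by the `a t_j` with `a ∈ I_j`. -/
noncomputable def multiReesAlgebra : Subalgebra A (MvPolynomial (Fin s) A) :=
  Algebra.adjoin A {f | ∃ j, ∃ a ∈ I j, f = a • MvPolynomial.X j}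

theorem smul_X_mem_multiReesAlgebra {j : Fin s} {a : A} (ha : a ∈ I j) :
    a • (MvPolynomial.X j : MvPolynomial (Fin s) A) ∈ multiReesAlgebra I :=
  Algebra.subset_adjoin ⟨j, a, ha, rfl⟩

instance [IsNoetherianRing A] : IsNoetherianRing (multiReesAlgebra I) := by
  refine isNoetherianRing_of_fg ?_
  choose G hG using fun j => IsNoetherian.noetherian (I j)
  have hfin : (⋃ j, (fun a : A => a • (MvPolynomial.X j : MvPolynomial (Fin s) A)) ''
      (G j : Set A)).Finite :=
    Set.finite_iUnion fun j => (G j).finite_toSet.image _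
  rw [Subalgebra.fg_def]
  refine ⟨_, hfin, le_antisymm (Algebra.adjoin_le ?_) (Algebra.adjoin_le ?_)⟩
  · intro f hf
    obtain ⟨j, a, ha, rfl⟩ := Set.mem_iUnion.1 hf
    exact smul_X_mem_multiReesAlgebra I (hG j ▸ Submodule.subset_span ha)
  · rintro _ ⟨j, a, ha, rfl⟩
    rw [← hG j] at ha
    induction ha using Submodule.span_induction with
    | mem a ha => exact Algebra.subset_adjoin (Set.mem_iUnion.2 ⟨j, a, ha, rfl⟩)
    | zero => rw [zero_smul]; exact Subalgebra.zero_mem _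
    | add a b _ _ ha hb => rw [add_smul]; exact Subalgebra.add_mem _ ha hb
    | smul c a _ ha => rw [smul_eq_mul, mul_smul]; exact Subalgebra.smul_mem _ ha c

theorem monomial_mem_multiReesAlgebra (n : Fin s →₀ ℕ) {a : A} (ha : a ∈ idealMonomial I n) :
    MvPolynomial.monomial n a ∈ multiReesAlgebra I := by
  induction n using Finsupp.induction_linear generalizing a with
  | zero => exact (multiReesAlgebra I).algebraMap_mem a
  | add m n hm hn =>
    rw [Finsupp.coe_add, idealMonomial_add] at ha
    induction ha using Submodule.mul_induction_on' with
    | mem_mul_mem a ha b hb =>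
      rw [← MvPolynomial.monomial_mul]
      exact Subalgebra.mul_mem _ (hm ha) (hn hb)
    | add a _ b _ ha hb => rw [map_add]; exact Subalgebra.add_mem _ ha hb
  | single j k =>
    rw [idealMonomial_single] at ha
    induction k generalizing a with
    | zero => rw [Finsupp.single_zero]; exact (multiReesAlgebra I).algebraMap_mem a
    | succ k ih =>
      rw [pow_succ] at ha
      induction ha using Submodule.mul_induction_on' with
      | mem_mul_mem a ha b hb =>
        rw [Finsupp.single_add, ← MvPolynomial.monomial_mul]
        refine Subalgebra.mul_mem _ (ih ha) ?_
        have := smul_X_mem_multiReesAlgebra I hb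
        rwa [MvPolynomial.X, MvPolynomial.smul_monomial, smul_eq_mul, mul_one] at this
      | add a _ b _ ha hb => rw [map_add]; exact Subalgebra.add_mem _ ha hb

variable (M : Type*) [AddCommGroup M] [Module A M]

/-- The coefficient of `tⁿ` in an element of `A[t₁, …, t_s] ⊗ M = M[t₁, …, t_s]`. -/
noncomputable def tensorCoeff (n : Fin s →₀ ℕ) : MvPolynomial (Fin s) A ⊗[A] M →ₗ[A] M :=
  (TensorProduct.lid A M).toLinearMap ∘ₗ (MvPolynomial.lcoeff A n).rTensor M

@[simp]
theorem tensorCoeff_tmul (n : Fin s →₀ ℕ) (p : MvPolynomial (Fin s) A) (m : M) :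
    tensorCoeff M n (p ⊗ₜ m) = p.coeff n • m := by
  simp [tensorCoeff]

theorem tensorCoeff_X_smul (n : Fin s →₀ ℕ) (j : Fin s) (a : A)
    (f : MvPolynomial (Fin s) A ⊗[A] M) :
    tensorCoeff M n ((a • (MvPolynomial.X j : MvPolynomial (Fin s) A)) • f) =
      if j ∈ n.support then a • tensorCoeff M (n - Finsupp.single j 1) f else 0 := by
  induction f using TensorProduct.induction_on with
  | zero => simp
  | tmul p m =>
    rw [TensorProduct.smul_tmul', tensorCoeff_tmul, tensorCoeff_tmul, smul_eq_mul, smul_mul_assoc,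
      MvPolynomial.coeff_smul, MvPolynomial.coeff_X_mul']
    split_ifs <;> simp [mul_smul]
  | add f g hf hg =>
    rw [smul_add, map_add, hf, hg]
    split_ifs <;> simp

variable {M}

/-- The submodule `⨁ₙ W n tⁿ` of `M[t₁, …, t_s]` over the multi-Rees algebra. The family `W` need
not be decreasing: closure under the algebra is the condition `I_j W n ⊆ W (n + e_j)`. -/
def gradedSubmodule (W : (Fin s →₀ ℕ) → Submodule A M)
    (hW : ∀ j n, I j • W n ≤ W (n + Finsupp.single j 1)) :
    Submodule (multiReesAlgebra I) (MvPolynomial (Fin s) A ⊗[A] M) where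
  carrier := {f | ∀ n, tensorCoeff M n f ∈ W n}
  zero_mem' n := by simp
  add_mem' hf hg n := by rw [map_add]; exact add_mem (hf n) (hg n)
  smul_mem' := by
    rintro ⟨r, hr⟩ f hf
    change ∀ n, tensorCoeff M n (r • f) ∈ W n
    induction hr using Algebra.adjoin_induction generalizing f with
    | mem r hr =>
      obtain ⟨j, a, ha, rfl⟩ := hr
      intro n
      rw [tensorCoeff_X_smul]
      split_ifs with hj
      · have := hW j (n - Finsupp.single j 1) (Submodule.smul_mem_smul ha (hf _))
        rwa [tsub_add_cancel_of_le] at this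
        rw [Finsupp.single_le_iff]
        exact Nat.one_le_iff_ne_zero.2 (Finsupp.mem_support_iff.1 hj)
      · exact zero_mem _
    | algebraMap a =>
      intro n
      rw [algebraMap_smul, map_smul]
      exact (W n).smul_mem a (hf n)
    | add r r' _ _ hr hr' =>
      intro n
      rw [add_smul, map_add]
      exact add_mem (hr hf n) (hr' hf n)
    | mul r r' _ _ hr hr' =>
      rw [mul_smul]
      exact hr (hr' hf)

theorem monomial_tmul_mem_gradedSubmodule_iff {W : (Fin s →₀ ℕ) → Submodule A M}
    {hW : ∀ j n, I j • W n ≤ W (n + Finsupp.single j 1)} {n : Fin s →₀ ℕ} {m : M} :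
    MvPolynomial.monomial n (1 : A) ⊗ₜ m ∈ gradedSubmodule I W hW ↔ m ∈ W n := by
  constructor
  · intro h
    simpa using h n
  · intro h k
    rw [tensorCoeff_tmul, MvPolynomial.coeff_monomial]
    split_ifs with hk
    · subst hk
      simpa using h
    · simp

variable (M) in
/-- The multi-Rees module `⨁ₙ I₁ ^ n₁ ⋯ I_s ^ n_s M tⁿ`, as the submodule of `M[t₁, …, t_s]`
generated by `M` over the multi-Rees algebra. -/
noncomputable def multiReesModule : Submodule (multiReesAlgebra I) (MvPolynomial (Fin s) A ⊗[A] M) :=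
  Submodule.span _ (Set.range fun m : M => (1 : MvPolynomial (Fin s) A) ⊗ₜ[A] m)

theorem multiReesModule_fg [Module.Finite A M] : (multiReesModule I M).FG := by
  obtain ⟨G, hG⟩ := Module.Finite.fg_top (R := A) (M := M)
  refine Submodule.fg_def.2
    ⟨_, (G.finite_toSet.image fun m : M => (1 : MvPolynomial (Fin s) A) ⊗ₜ[A] m), ?_⟩
  refine le_antisymm (Submodule.span_mono (Set.image_subset_range _ _)) (Submodule.span_le.2 ?_)
  rintro _ ⟨m, rfl⟩
  have hm : m ∈ Submodule.span A (G : Set M) := hG ▸ Submodule.mem_top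
  induction hm using Submodule.span_induction with
  | mem m hm => exact Submodule.subset_span ⟨m, hm, rfl⟩
  | zero => simp
  | add m m' _ _ hm hm' => simp only [TensorProduct.tmul_add]; exact add_mem hm hm'
  | smul a m _ hm =>
    simp only [TensorProduct.tmul_smul]
    exact Submodule.smul_of_tower_mem _ a hm

theorem monomial_tmul_mem_multiReesModule {n : Fin s →₀ ℕ} {m : M}
    (hm : m ∈ idealMonomial I n • (⊤ : Submodule A M)) :
    MvPolynomial.monomial n (1 : A) ⊗ₜ m ∈ multiReesModule I M := by
  induction hm using Submodule.smul_induction_on' with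
  | smul a ha m _ =>
    have h : MvPolynomial.monomial n (1 : A) ⊗ₜ[A] (a • m) =
        (⟨_, monomial_mem_multiReesAlgebra I n ha⟩ : multiReesAlgebra I) •
          ((1 : MvPolynomial (Fin s) A) ⊗ₜ[A] m) := by
      rw [Subalgebra.smul_def, TensorProduct.smul_tmul', TensorProduct.tmul_smul,
        TensorProduct.smul_tmul', MvPolynomial.smul_monomial]
      simp
    rw [h]
    exact Submodule.smul_mem _ _ (Submodule.subset_span ⟨m, rfl⟩)
  | add m _ m' _ hm hm' => rw [TensorProduct.tmul_add]; exact add_mem hm hm'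

end MultiRees

/-! ### Graded submodules are generated in bounded degrees -/

section GradedStability

variable {A : Type*} [CommRing A] [IsNoetherianRing A] {s : ℕ} (I : Fin s → Ideal A)
  {M : Type*} [AddCommGroup M] [Module A M] [Module.Finite A M]

/-- Graded submodules of the multi-Rees module satisfy the ascending chain condition. -/
theorem exists_forall_eq_of_monotone_gradedSubmodule
    (V : ℕ → (Fin s →₀ ℕ) → Submodule A M) (hmono : Monotone V)
    (hV : ∀ c j n, I j • V c n ≤ V c (n + Finsupp.single j 1))
    (hle : ∀ c n, V c n ≤ idealMonomial I n • ⊤) :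
    ∃ c, ∀ d, c ≤ d → V c = V d := by
  obtain ⟨c, hc⟩ := (multiReesModule_fg I (M := M)).exists_forall_eq_of_monotone
    (F := fun c => gradedSubmodule I (V c) (hV c)) fun c d hcd f hf n => hmono hcd n (hf n)
  refine ⟨c, fun d hd => funext fun n => le_antisymm (hmono hd n) fun m hm => ?_⟩
  have hmem := (hc d hd).ge ⟨(monomial_tmul_mem_gradedSubmodule_iff I (hW := hV d)).2 hm,
    monomial_tmul_mem_multiReesModule I (hle d n hm)⟩
  exact (monomial_tmul_mem_gradedSubmodule_iff I (hW := hV c)).1 hmem.1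

/-- A multigraded Artin–Rees lemma: a graded submodule `⨁ₙ W n tⁿ` of the multi-Rees module is
generated in bounded degrees, so that `W` grows only through `I_i` in the direction `i` once
`n_i` is large, with a bound independent of the other exponents. -/
theorem exists_forall_pow_smul_eq_of_le_idealMonomial_smul
    (W : (Fin s →₀ ℕ) → Submodule A M)
    (hW : ∀ j n, I j • W n ≤ W (n + Finsupp.single j 1))
    (hle : ∀ n, W n ≤ idealMonomial I n • ⊤) (i : Fin s) :
    ∃ c, ∀ n : Fin s →₀ ℕ, c ≤ n i → ∀ k, W (n + Finsupp.single i k) = I i ^ k • W n := by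
  classical
  have hpow : ∀ k n, I i ^ k • W n ≤ W (n + Finsupp.single i k) := by
    intro k
    induction k with
    | zero => intro n; simp
    | succ k ih =>
      intro n
      rw [pow_succ', Submodule.mul_smul, Finsupp.single_add, ← add_assoc]
      exact (Submodule.smul_mono le_rfl (ih n)).trans (hW i _)
  -- `V c` is the family generated by the members of `W` whose `i`-th degree is at most `c`; the
  -- increasing sequence of the `V c` has union `W`.
  let V : ℕ → (Fin s →₀ ℕ) → Submodule A M := fun c n =>
    I i ^ (n i - c) • W (n.update i (min (n i) c))
  have hV_of_le : ∀ {c : ℕ} {n : Fin s →₀ ℕ}, n i ≤ c → V c n = W n := by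
    intro c n h
    simp [V, h]
  have hV_of_add : ∀ {c : ℕ} {n : Fin s →₀ ℕ} (k : ℕ), n i = c →
      V c (n + Finsupp.single i k) = I i ^ k • W n := by
    intro c n k h
    have : (n + Finsupp.single i k).update i (min ((n + Finsupp.single i k) i) c) = n := by
      ext j
      rcases eq_or_ne j i with rfl | hj
      · simp [h]
      · simp [hj]
    simp only [V, this]
    simp [h]
  have hdecomp : ∀ {c : ℕ} {n : Fin s →₀ ℕ}, c ≤ n i →
      ∃ n' : Fin s →₀ ℕ, n' i = c ∧ n = n' + Finsupp.single i (n i - c) := by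
    intro c n h
    refine ⟨n.update i c, by simp, ?_⟩
    ext j
    rcases eq_or_ne j i with rfl | hj
    · simp [h]
    · simp [hj]
  have hV_le : ∀ c n, V c n ≤ W n := by
    intro c n
    rcases le_total (n i) c with h | h
    · exact (hV_of_le h).le
    · obtain ⟨n', hn', hn⟩ := hdecomp h
      rw [hn, hV_of_add _ hn']
      exact hpow _ _
  have hmono : Monotone V := by
    refine monotone_nat_of_le_succ fun c n => ?_
    rcases Nat.lt_or_ge c (n i) with h | h
    · obtain ⟨n', hn', hn⟩ := hdecomp h.le
      obtain ⟨k, hk⟩ : ∃ k, n i - c = k + 1 := ⟨n i - c - 1, by omega⟩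
      rw [hn, hk, hV_of_add _ hn', pow_succ, Submodule.mul_smul, add_comm k, Finsupp.single_add,
        ← add_assoc, hV_of_add k (by simp [hn'])]
      exact Submodule.smul_mono le_rfl (hW i n')
    · rw [hV_of_le h, hV_of_le (by omega)]
  have hVI : ∀ c j n, I j • V c n ≤ V c (n + Finsupp.single j 1) := by
    intro c j n
    rcases le_or_gt c (n i) with h | h
    · obtain ⟨n', hn', hn⟩ := hdecomp h
      rw [hn, hV_of_add _ hn', add_right_comm]
      rcases eq_or_ne j i with rfl | hj
      · rw [add_right_comm, add_assoc, ← Finsupp.single_add, hV_of_add _ hn', ← Submodule.mul_smul,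
          ← pow_succ']
      · rw [hV_of_add _ (by simp [hn', hj.symm]), ← Submodule.mul_smul, mul_comm,
          Submodule.mul_smul]
        exact Submodule.smul_mono le_rfl (hW j n')
    · rw [hV_of_le h.le, hV_of_le]
      · exact hW j n
      · rcases eq_or_ne j i with rfl | hj
        · simpa using h
        · simpa [hj.symm] using h.le
  obtain ⟨c, hc⟩ := exists_forall_eq_of_monotone_gradedSubmodule I V hmono hVI
    fun c n => (hV_le c n).trans (hle n)
  have hWV : ∀ n, W n = V c n := fun n => by
    rw [hc (max c (n i)) (le_max_left _ _), hV_of_le (le_max_right _ _)]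
  refine ⟨c, fun n hn k => ?_⟩
  obtain ⟨n', hn', hn⟩ := hdecomp hn
  rw [hWV, hWV n, hn, add_assoc, ← Finsupp.single_add, hV_of_add _ hn', hV_of_add _ hn',
    add_comm, pow_add, Submodule.mul_smul]

end GradedStability

/-! ### Existence of superficial elements -/

section DegreeOne

variable {A : Type*} [CommRing A] {s : ℕ} (I : Fin s → Ideal A)
  (M : Type*) [AddCommGroup M] [Module A M]

/-- The `A`-linear map `a ↦ a t_i` from `I_i` to `A[I₁ t₁, …, I_s t_s]`. -/
noncomputable def degreeOneInclusion (i : Fin s) : I i →ₗ[A] multiReesAlgebra I :=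
  ((LinearMap.toSpanSingleton A (MvPolynomial (Fin s) A) (MvPolynomial.X i)).comp
    (I i).subtype).codRestrict (Subalgebra.toSubmodule (multiReesAlgebra I))
      fun a => smul_X_mem_multiReesAlgebra I a.2

theorem coe_degreeOneInclusion (i : Fin s) (a : I i) :
    (degreeOneInclusion I i a : MvPolynomial (Fin s) A) =
      MvPolynomial.monomial (Finsupp.single i 1) (a : A) := by
  change (a : A) • (MvPolynomial.X i : MvPolynomial (Fin s) A) = _
  rw [MvPolynomial.X, MvPolynomial.smul_monomial, smul_eq_mul, mul_one]

/-- The power `(I_i t_i) ^ k` contains `a t_i ^ k` for every `a ∈ I_i ^ k`. -/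
theorem exists_mem_pow_span_degreeOneInclusion (i : Fin s) (k : ℕ) {a : A} (ha : a ∈ I i ^ k) :
    ∃ r ∈ Ideal.span (Set.range (degreeOneInclusion I i)) ^ k,
      (r : MvPolynomial (Fin s) A) = MvPolynomial.monomial (Finsupp.single i k) a := by
  induction k generalizing a with
  | zero => exact ⟨algebraMap A _ a, by simp, by rw [Finsupp.single_zero]; rfl⟩
  | succ k ih =>
    rw [pow_succ] at ha
    induction ha using Submodule.mul_induction_on' with
    | mem_mul_mem a ha b hb =>
      obtain ⟨r, hr, hra⟩ := ih ha
      refine ⟨r * degreeOneInclusion I i ⟨b, hb⟩, ?_, ?_⟩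
      · rw [pow_succ]
        exact Ideal.mul_mem_mul hr (Ideal.subset_span ⟨_, rfl⟩)
      · rw [MulMemClass.coe_mul, hra, coe_degreeOneInclusion, MvPolynomial.monomial_mul,
          ← Finsupp.single_add]
    | add a _ b _ ha hb =>
      obtain ⟨r, hr, hra⟩ := ha
      obtain ⟨r', hr', hrb⟩ := hb
      exact ⟨r + r', add_mem hr hr', by rw [AddMemClass.coe_add, hra, hrb, map_add]⟩

variable {I M} in
/-- The set `Ps` is the set of associated primes over the multi-Rees algebra of
`⨁ₙ I₁ ^ n₁ ⋯ I_s ^ n_s M / I₁ ^ n₁ ⋯ I_j ^ (n_j + 1) ⋯ I_s ^ n_s M`: an element of `I_i t_i` outside those `P ∈ Ps` that do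
not contain `I_i t_i` has kernel annihilated by a power of `I_i t_i`. -/
theorem exists_finite_forall_exists_pow_smul_mem_idealMonomial_smul [IsNoetherianRing A]
    [Module.Finite A M] (i j : Fin s) :
    ∃ Ps : Set (Ideal (multiReesAlgebra I)), Ps.Finite ∧ ∀ x : I i,
      (∀ P ∈ Ps, degreeOneInclusion I i x ∈ P →
        Ideal.span (Set.range (degreeOneInclusion I i)) ≤ P) →
      ∃ k : ℕ, ∀ n : Fin s →₀ ℕ, ∀ z ∈ idealMonomial I n • (⊤ : Submodule A M),
        (x : A) • z ∈ idealMonomial I ⇑(n + Finsupp.single i 1 + Finsupp.single j 1 : Fin s →₀ ℕ) •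
          (⊤ : Submodule A M) →
        ∀ a ∈ I i ^ k, a • z ∈
          idealMonomial I ⇑(n + Finsupp.single i k + Finsupp.single j 1 : Fin s →₀ ℕ) •
            (⊤ : Submodule A M) := by
  let D := gradedSubmodule I
    (fun n => idealMonomial I ⇑(n + Finsupp.single j 1 : Fin s →₀ ℕ) • (⊤ : Submodule A M))
    (fun j' n => by rw [smul_idealMonomial_smul_top, add_right_comm])
  obtain ⟨Ps, hfin, hPs⟩ :=
    (multiReesModule_fg I (M := M)).exists_finite_forall_exists_pow_smul_mem D
  refine ⟨Ps, hfin, fun x hx => ?_⟩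
  obtain ⟨k, hk⟩ := hPs _ _ hx
  refine ⟨k, fun n z hz hxz a ha => ?_⟩
  have hmul : ∀ (r : multiReesAlgebra I) (d : Fin s →₀ ℕ) (b : A),
      (r : MvPolynomial (Fin s) A) = MvPolynomial.monomial d b →
      (r • (MvPolynomial.monomial n (1 : A) ⊗ₜ[A] z) ∈ D ↔
        b • z ∈ idealMonomial I ⇑(n + d + Finsupp.single j 1 : Fin s →₀ ℕ) •
          (⊤ : Submodule A M)) := by
    intro r d b hr
    have hval : r • (MvPolynomial.monomial n (1 : A) ⊗ₜ[A] z) =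
        MvPolynomial.monomial (n + d) (1 : A) ⊗ₜ (b • z) := by
      rw [Subalgebra.smul_def, hr, TensorProduct.smul_tmul', TensorProduct.tmul_smul,
        TensorProduct.smul_tmul', MvPolynomial.smul_monomial, smul_eq_mul,
        MvPolynomial.monomial_mul, add_comm d n, smul_eq_mul]
    rw [hval]
    exact monomial_tmul_mem_gradedSubmodule_iff I
  obtain ⟨r, hr, hra⟩ := exists_mem_pow_span_degreeOneInclusion I i k ha
  refine (hmul r _ a hra).1 (hk _ (monomial_tmul_mem_multiReesModule I hz) ?_ r hr)
  exact (hmul _ _ x (coe_degreeOneInclusion I i x)).2 hxz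

end DegreeOne

section Superficial

variable {A : Type*} [CommRing A] {s : ℕ} (I : Fin s → Ideal A)
  {M : Type*} [AddCommGroup M] [Module A M]

theorem mem_span_singleton_smul_iff {x : A}
    {N : Submodule A M} {z : M} : z ∈ Ideal.span {x} • N ↔ ∃ y ∈ N, x • y = z := by
  rw [Submodule.ideal_span_singleton_smul, Submodule.mem_smul_pointwise_iff_exists]

/-- The elements `z ∈ I₁ ^ n₁ ⋯ I_s ^ n_s M` whose multiple `x z` lies one step too deep in the
direction `j` form a graded submodule, generated in bounded degrees. As a power of `I_i` moves them
one step deeper in the direction `j`, they are that deep themselves once `n_i` is large. -/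
theorem exists_forall_mem_of_smul_mem [IsNoetherianRing A] [Module.Finite A M] {i j : Fin s} {x : A}
    {k : ℕ}
    (hk : ∀ n : Fin s →₀ ℕ, ∀ z ∈ idealMonomial I n • (⊤ : Submodule A M),
      x • z ∈ idealMonomial I ⇑(n + Finsupp.single i 1 + Finsupp.single j 1 : Fin s →₀ ℕ) •
        (⊤ : Submodule A M) →
      ∀ a ∈ I i ^ k, a • z ∈
        idealMonomial I ⇑(n + Finsupp.single i k + Finsupp.single j 1 : Fin s →₀ ℕ) •
          (⊤ : Submodule A M)) :
    ∃ c, ∀ n : Fin s →₀ ℕ, c ≤ n i → ∀ z ∈ idealMonomial I n • (⊤ : Submodule A M),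
      x • z ∈ idealMonomial I ⇑(n + Finsupp.single i 1 + Finsupp.single j 1 : Fin s →₀ ℕ) •
        (⊤ : Submodule A M) →
      z ∈ idealMonomial I ⇑(n + Finsupp.single j 1 : Fin s →₀ ℕ) • (⊤ : Submodule A M) := by
  let W : (Fin s →₀ ℕ) → Submodule A M := fun n =>
    idealMonomial I n • (⊤ : Submodule A M) ⊓
      (idealMonomial I ⇑(n + Finsupp.single i 1 + Finsupp.single j 1 : Fin s →₀ ℕ) •
        (⊤ : Submodule A M)).comap (LinearMap.lsmul A M x)
  have hW : ∀ j' n, I j' • W n ≤ W (n + Finsupp.single j' 1) := by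
    intro j' n
    rw [Submodule.smul_le]
    rintro a ha z ⟨hz, hxz⟩
    refine ⟨?_, ?_⟩
    · exact (smul_idealMonomial_smul_top I M n j').le (Submodule.smul_mem_smul ha hz)
    · have := Submodule.smul_mem_smul ha (Submodule.mem_comap.1 hxz)
      rw [smul_idealMonomial_smul_top] at this
      rwa [← map_smul, add_right_comm, add_right_comm n] at this
  obtain ⟨c, hc⟩ := exists_forall_pow_smul_eq_of_le_idealMonomial_smul I W hW
    (fun n => inf_le_left) i
  refine ⟨c + k, fun n hn z hz hxz => ?_⟩
  obtain ⟨m, rfl⟩ : ∃ m, n = m + Finsupp.single i k :=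
    ⟨n - Finsupp.single i k, (tsub_add_cancel_of_le
      (Finsupp.single_le_iff.2 (le_of_add_le_right hn))).symm⟩
  have hzW : z ∈ W (m + Finsupp.single i k) := ⟨hz, hxz⟩
  rw [hc m (by simpa using hn)] at hzW
  refine (Submodule.smul_le.2 fun a ha y hy => ?_ : I i ^ k • W m ≤ _) hzW
  exact hk m y hy.1 hy.2 a ha

/-- A criterion for superficiality. By Artin–Rees, an element of
`xM ∩ I₁ ^ n₁ ⋯ I_i ^ (n_i + 1) ⋯ I_s ^ n_s M` is `x z` with `z ∈ I_i ^ k M` for a large `k`. The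
hypothesis, applied once for each unit step in each direction `j`, moves `z` from `I_i ^ k M` into
`I₁ ^ n₁ ⋯ I_s ^ n_s M`. The directions `j ≠ i` are needed because the Artin–Rees step forgets the
exponents other than `n_i`. -/
theorem isReesSuperficialElement_of_forall_mem_of_smul_mem [IsNoetherianRing A] [Module.Finite A M]
    {i : Fin s} {x : A} (hx : x ∈ I i)
    (h : ∀ j, ∃ c, ∀ n : Fin s →₀ ℕ, c ≤ n i → ∀ z ∈ idealMonomial I n • (⊤ : Submodule A M),
      x • z ∈ idealMonomial I ⇑(n + Finsupp.single i 1 + Finsupp.single j 1 : Fin s →₀ ℕ) •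
        (⊤ : Submodule A M) →
      z ∈ idealMonomial I ⇑(n + Finsupp.single j 1 : Fin s →₀ ℕ) • (⊤ : Submodule A M)) :
    IsReesSuperficialElement I M x := by
  choose c hc using h
  obtain ⟨b, hb⟩ : ∃ b, ∀ j, c j ≤ b := ⟨Finset.univ.sup c, fun j => Finset.le_sup (by simp)⟩
  have hle : ∀ {m n : Fin s →₀ ℕ}, m ≤ n → idealMonomial I n • (⊤ : Submodule A M) ≤
      idealMonomial I m • (⊤ : Submodule A M) := fun h =>
    Submodule.smul_mono_left (idealMonomial_antitone I h)
  have hclimb : ∀ m n : Fin s →₀ ℕ, b ≤ n i → ∀ z ∈ idealMonomial I n • (⊤ : Submodule A M),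
      x • z ∈ idealMonomial I ⇑(n + m + Finsupp.single i 1 : Fin s →₀ ℕ) • (⊤ : Submodule A M) →
      z ∈ idealMonomial I ⇑(n + m : Fin s →₀ ℕ) • (⊤ : Submodule A M) := by
    intro m
    induction m using Finsupp.induction_linear with
    | zero => intro n _ z hz _; simpa using hz
    | add m m' hm hm' =>
      intro n hn z hz hxz
      rw [← add_assoc] at hxz ⊢
      refine hm' _ (by simp; omega) z (hm n hn z hz (hle (fun a => ?_) hxz)) hxz
      simp only [Finsupp.add_apply]
      omega
    | single j k =>
      induction k with
      | zero => intro n _ z hz _; simpa using hz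
      | succ k ih =>
        intro n hn z hz hxz
        rw [Finsupp.single_add, ← add_assoc] at hxz ⊢
        refine hc j _ ((hb j).trans (by simp; omega)) z (ih n hn z hz (hle (fun a => ?_) hxz)) ?_
        · simp only [Finsupp.add_apply]
          omega
        · rwa [add_right_comm]
  -- Artin–Rees: `xM ∩ I^n M` is generated in bounded degrees.
  obtain ⟨d, hd⟩ := exists_forall_pow_smul_eq_of_le_idealMonomial_smul I
    (fun n => Ideal.span {x} • (⊤ : Submodule A M) ⊓ idealMonomial I n • ⊤) (fun j n => by
      rw [← smul_idealMonomial_smul_top]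
      exact le_inf ((Submodule.smul_mono le_rfl inf_le_left).trans Submodule.smul_le_right)
        (Submodule.smul_mono le_rfl inf_le_right)) (fun n => inf_le_right) i
  refine ⟨i, hx, b + d + 1, fun n hn => ?_⟩
  obtain ⟨n, rfl⟩ := Finsupp.equivFunOnFinite.surjective n
  simp only [Finsupp.equivFunOnFinite_apply] at hn ⊢
  have hupd : idealMonomial I (Function.update (⇑n) i (n i + 1)) =
      idealMonomial I ⇑(n + Finsupp.single i 1 : Fin s →₀ ℕ) := by
    rw [idealMonomial_update_add_one, Finsupp.coe_add, idealMonomial_add, idealMonomial_single,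
      pow_one, mul_comm]
  have hcoe : (Finsupp.equivFunOnFinite n : Fin s → ℕ) = ⇑n := rfl
  rw [hcoe, hupd]
  refine le_antisymm ?_ (le_inf (Submodule.smul_mono le_rfl le_top) ?_)
  · intro y hy
    -- Artin–Rees is applied with `I_i ^ b`, the least power from which `hclimb` starts.
    have hle' : Finsupp.single i b ≤ n + Finsupp.single i 1 :=
      Finsupp.single_le_iff.2 (by simp; omega)
    rw [← tsub_add_cancel_of_le hle', hd _ (by simp; omega)] at hy
    have hy' := Submodule.smul_mono le_rfl inf_le_left hy
    rw [← Submodule.mul_smul, mul_comm, Submodule.mul_smul, mem_span_singleton_smul_iff] at hy'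
    obtain ⟨z, hz, rfl⟩ := hy'
    rw [← idealMonomial_single] at hz
    refine mem_span_singleton_smul_iff.2 ⟨z, ?_, rfl⟩
    have hadd : Finsupp.single i b + (n - Finsupp.single i b) = n :=
      add_tsub_cancel_of_le (Finsupp.single_le_iff.2 (by omega))
    have := hclimb (n - Finsupp.single i b) (Finsupp.single i b) (by simp) z hz
    rw [hadd] at this
    refine this ?_
    have h2 := (hd _ (by simp; omega) b).ge hy
    rw [tsub_add_cancel_of_le hle'] at h2
    exact h2.2
  · rw [← smul_idealMonomial_smul_top]
    exact Submodule.smul_mono_left ((Ideal.span_singleton_le_iff_mem _).2 hx)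

variable (M) in
/-- **Rees's lemma** on the existence of superficial elements, which may moreover be chosen outside
any finite set of ideals not containing `I_i`: all conditions say that `x` avoids finitely many
proper submodules of `I_i`. -/
theorem exists_isReesSuperficialElement [IsNoetherianRing A] [IsLocalRing A]
    [Infinite (IsLocalRing.ResidueField A)] [Module.Finite A M] (i : Fin s) {Qs : Set (Ideal A)}
    (hQs : Qs.Finite) :
    ∃ x ∈ I i, IsReesSuperficialElement I M x ∧ ∀ Q ∈ Qs, x ∈ Q → I i ≤ Q := by
  choose Ps hfin hPs using fun j =>
    exists_finite_forall_exists_pow_smul_mem_idealMonomial_smul (I := I) (M := M) i j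
  let 𝒰 : Set (Submodule A (I i)) :=
    ((⋃ j, (fun P : Ideal (multiReesAlgebra I) =>
      (P.restrictScalars A).comap (degreeOneInclusion I i)) '' Ps j) ∪
      (fun Q : Ideal A => Submodule.comap (I i).subtype Q) '' Qs) \ {⊤}
  obtain ⟨x, hx⟩ := exists_forall_notMem_of_infinite_residueField (𝒰 := 𝒰)
    (((Set.finite_iUnion fun j => (hfin j).image _).union (hQs.image _)).sdiff) (by simp [𝒰])
  refine ⟨x, x.2, ?_, fun Q hQ hxQ => ?_⟩
  · refine isReesSuperficialElement_of_forall_mem_of_smul_mem I x.2 fun j => ?_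
    obtain ⟨k, hk⟩ := hPs j x fun P hP hxP => by
      by_contra hnot
      refine hx ((P.restrictScalars A).comap (degreeOneInclusion I i))
        ⟨Or.inl (Set.mem_iUnion.2 ⟨j, P, hP, rfl⟩), fun htop => hnot ?_⟩ hxP
      rw [Ideal.span_le]
      rintro _ ⟨a, rfl⟩
      exact (Set.mem_singleton_iff.1 htop).ge (Submodule.mem_top (x := a))
    exact exists_forall_mem_of_smul_mem I hk
  · by_contra hnot
    refine hx (Submodule.comap (I i).subtype Q) ⟨Or.inr ⟨Q, hQ, rfl⟩, fun htop => hnot ?_⟩ hxQ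
    exact fun a ha => (Set.mem_singleton_iff.1 htop).ge (Submodule.mem_top (x := ⟨a, ha⟩))

end Superficial

/-! ### Dimension and systems of parameters -/

section Dimension

open IsLocalRing

variable {A : Type*} [CommRing A] {M : Type*} [AddCommGroup M] [Module A M]

/-- If a chain of length `n` in `Supp M` starts at a prime containing `K`, then
`ht ((K + Ann M) / Ann M) + n ≤ dim M`. -/
theorem height_map_add_length_le_supportDim [Module.Finite A M] {K : Ideal A} (l : LTSeries (Module.support A M))
    (hK : K ≤ l.head.1.asIdeal) :
    ((((K ⊔ Module.annihilator A M).map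
      (Ideal.Quotient.mk (Module.annihilator A M))).height + l.length : ℕ∞) : WithBot ℕ∞) ≤
      Module.supportDim A M := by
  rw [Module.supportDim_eq_ringKrullDim_quotient_annihilator]
  let e := (Module.annihilator A M).primeSpectrumQuotientOrderIsoZeroLocus
  have hmem : ∀ p : Module.support A M, p.1 ∈ PrimeSpectrum.zeroLocus (Module.annihilator A M) :=
    fun p => Module.support_eq_zeroLocus (R := A) (M := M) ▸ p.2
  let l' : LTSeries (PrimeSpectrum (A ⧸ Module.annihilator A M)) :=
    l.map (fun p => e.symm ⟨p.1, hmem p⟩) fun p q hpq => e.symm.strictMono hpq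
  have : Nonempty (PrimeSpectrum (A ⧸ Module.annihilator A M)) := ⟨l'.head⟩
  rw [ringKrullDim, Order.krullDim_eq_iSup_height_add_coheight_of_nonempty]
  refine WithBot.coe_le_coe.2 (le_trans (add_le_add ?_ ?_) (le_iSup (fun p => Order.height p + Order.coheight p) l'.head))
  · rw [← PrimeSpectrum.height_eq_orderHeight]
    refine Ideal.height_mono (Ideal.map_le_iff_le_comap.2 ?_)
    have hcomap : l'.head.asIdeal.comap (Ideal.Quotient.mk (Module.annihilator A M)) =
        l.head.1.asIdeal :=
      congrArg (fun p => p.1.asIdeal) (e.apply_symm_apply ⟨l.head.1, hmem l.head⟩)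
    rw [hcomap]
    exact sup_le hK (hmem l.head)
  · exact Order.length_le_coheight_head (p := l')

/-- If `x` avoids the minimal primes of `N` that do not contain `K`, and
`ht ((K + Ann M) / Ann M) > dim M - dim N`, then `x` is a parameter for `N`, since no minimal prime
of `N` of maximal coheight contains `K`. -/
theorem supportDim_quotSMulTop_lt [Module.Finite A M] {N : Type*} [AddCommGroup N] [Module A N] [Module.Finite A N]
    (hsupp : Module.support A N ⊆ Module.support A M) {K : Ideal A} {n : ℕ}
    (hn : Module.supportDim A N = n)
    (hK : Module.supportDim A M < ((((K ⊔ Module.annihilator A M).map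
      (Ideal.Quotient.mk (Module.annihilator A M))).height + n : ℕ∞) : WithBot ℕ∞)) {x : A}
    (hx : ∀ p ∈ (Module.annihilator A N).minimalPrimes, x ∈ p → K ≤ p) :
    Module.supportDim A (QuotSMulTop x N) < n := by
  by_contra! hle
  obtain ⟨l, hl⟩ := Order.le_krullDim_iff.1 hle
  have hle' : Module.support A (QuotSMulTop x N) ⊆ Module.support A N := by simp
  let q : LTSeries (Module.support A N) := l.map (Set.inclusion hle') fun _ _ h => h
  have hxq : x ∈ q.head.1.asIdeal := by
    exact ((Module.support_quotSMulTop (R := A) (M := N) x).le l.head.2).2 rfl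
  obtain ⟨r, hr, hrq⟩ :=
    Ideal.exists_minimalPrimes_le (Module.mem_support_iff_of_finite.1 q.head.2)
  have hr' : r = q.head.1.asIdeal := by
    by_contra hne
    let r' : Module.support A N :=
      ⟨⟨r, hr.isPrime⟩, Module.mem_support_iff_of_finite.2 hr.1.2⟩
    have hlt : r' < q.head := lt_of_le_of_ne hrq fun h => hne (congrArg (fun p => p.1.asIdeal) h)
    have hlen := Order.LTSeries.length_le_krullDim (q.cons r' hlt)
    rw [← Module.supportDim, hn] at hlen
    rw [RelSeries.cons_length] at hlen
    have hlen' : q.length + 1 ≤ n := by exact_mod_cast hlen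
    have hlen'' : q.length = n := hl
    omega
  have hKq : K ≤ q.head.1.asIdeal := hr' ▸ hx r hr (hr' ▸ hxq)
  have := height_map_add_length_le_supportDim
    (q.map (Set.inclusion hsupp) fun _ _ h => h) (K := K) hKq
  refine absurd hK (not_lt.2 (le_trans (le_of_eq ?_) this))
  change _ = (((_ + ((l.length : ℕ) : ℕ∞) : ℕ∞)) : WithBot ℕ∞)
  rw [hl]

variable [Module.Finite A M]

theorem support_quotient_ofList_concat (xs : List A) (x : A) :
    Module.support A (M ⧸ (Ideal.ofList (xs ++ [x]) • ⊤ : Submodule A M)) =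
      Module.support A (QuotSMulTop x (M ⧸ (Ideal.ofList xs • ⊤ : Submodule A M))) := by
  rw [Module.support_quotSMulTop, Module.support_quotient, Module.support_quotient,
    Ideal.ofList_append, Ideal.ofList_singleton, PrimeSpectrum.zeroLocus_sup,
    PrimeSpectrum.zeroLocus_span {x}, Set.inter_assoc]

theorem supportDim_quotient_ofList_concat (xs : List A) (x : A) :
    Module.supportDim A (M ⧸ (Ideal.ofList (xs ++ [x]) • ⊤ : Submodule A M)) =
      Module.supportDim A (QuotSMulTop x (M ⧸ (Ideal.ofList xs • ⊤ : Submodule A M))) := by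
  rw [Module.supportDim, Module.supportDim, support_quotient_ofList_concat]

variable [IsNoetherianRing A]

theorem isFiniteLength_of_supportDim_eq_zero (h : Module.supportDim A M = 0) :
    IsFiniteLength A M := by
  rw [isFiniteLength_iff_isNoetherian_isArtinian]
  refine ⟨inferInstance, ?_⟩
  have hdim : Ring.KrullDimLE 0 (A ⧸ Module.annihilator A M) := by
    rw [Ring.KrullDimLE, Order.krullDimLE_iff, ← ringKrullDim,
      ← Module.supportDim_eq_ringKrullDim_quotient_annihilator, h]
    rfl
  have hart : IsArtinianRing (A ⧸ Module.annihilator A M) :=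
    IsNoetherianRing.isArtinianRing_of_krullDimLE_zero
  let _ : Module (A ⧸ Module.annihilator A M) M :=
    Module.IsTorsionBySet.module fun m a => Module.mem_annihilator.1 a.2 m
  have : IsScalarTower A (A ⧸ Module.annihilator A M) M :=
    Module.IsTorsionBySet.isScalarTower _
  have : Module.Finite (A ⧸ Module.annihilator A M) M :=
    Module.Finite.of_restrictScalars_finite A _ M
  have : IsArtinian (A ⧸ Module.annihilator A M) M := isArtinian_of_fg_of_artinian'
  exact isArtinian_of_surjective_algebraMap (R := A ⧸ Module.annihilator A M)
    Ideal.Quotient.mk_surjective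

variable [IsLocalRing A]

theorem exists_maximalIdeal_pow_le_annihilator (h : IsFiniteLength A M) :
    ∃ k, maximalIdeal A ^ k ≤ Module.annihilator A M := by
  have := (isFiniteLength_iff_isNoetherian_isArtinian.1 h).2
  obtain ⟨k, hk⟩ := IsArtinian.monotone_stabilizes (R := A) (M := M)
    ⟨fun k => OrderDual.toDual (maximalIdeal A ^ k • (⊤ : Submodule A M)), fun a b hab =>
      Submodule.smul_mono_left (Ideal.pow_le_pow_right hab)⟩
  have hk' : maximalIdeal A ^ k • (⊤ : Submodule A M) = maximalIdeal A ^ (k + 1) • ⊤ :=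
    hk (k + 1) k.le_succ
  have hbot : maximalIdeal A ^ k • (⊤ : Submodule A M) = ⊥ := by
    refine Submodule.eq_bot_of_le_smul_of_le_jacobson_bot (maximalIdeal A) _
      (IsNoetherian.noetherian _) ?_ (maximalIdeal_le_jacobson ⊥)
    rw [← Submodule.mul_smul, ← pow_succ', ← hk']
  refine ⟨k, fun a ha => Module.mem_annihilator.2 fun m => ?_⟩
  rw [← Submodule.mem_bot A, ← hbot]
  exact Submodule.smul_mem_smul ha Submodule.mem_top

theorem maximalIdeal_le_radical_of_isFiniteLength {J : Ideal A}
    (h : IsFiniteLength A (M ⧸ (J • ⊤ : Submodule A M))) :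
    maximalIdeal A ≤ (J ⊔ Module.annihilator A M).radical := by
  obtain ⟨k, hk⟩ := exists_maximalIdeal_pow_le_annihilator h
  rw [Ideal.radical_eq_sInf, le_sInf_iff]
  rintro P ⟨hP, hPp⟩
  have hmem : (⟨P, hPp⟩ : PrimeSpectrum A) ∈
      Module.support A (M ⧸ (J • ⊤ : Submodule A M)) := by
    rw [Module.support_quotient]
    exact ⟨Module.mem_support_iff_of_finite.2 (le_sup_right.trans hP), le_sup_left.trans hP⟩
  exact hPp.le_of_pow_le (hk.trans (Module.mem_support_iff_of_finite.1 hmem))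

omit [Module.Finite A M] in
theorem exists_supportDim_eq_natCast [Nontrivial M] : ∃ d : ℕ, Module.supportDim A M = d := by
  obtain ⟨d, hd⟩ := WithBot.ne_bot_iff_exists.1 (Module.supportDim_ne_bot_of_nontrivial A M)
  have hlt := (Module.supportDim_le_ringKrullDim A M).trans_lt ringKrullDim_lt_top
  rw [← hd] at hlt
  obtain ⟨n, rfl⟩ := ENat.ne_top_iff_exists.1 (WithBot.coe_lt_coe.1 hlt).ne
  exact ⟨n, hd.symm⟩

theorem supportDim_quotient_ofList_concat_eq {xs : List A} {x : A} {n : ℕ}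
    (hx : x ∈ maximalIdeal A)
    (hn : Module.supportDim A (M ⧸ (Ideal.ofList xs • ⊤ : Submodule A M)) = (n + 1 : ℕ))
    (hlt : Module.supportDim A (QuotSMulTop x (M ⧸ (Ideal.ofList xs • ⊤ : Submodule A M))) <
      (n + 1 : ℕ)) :
    Module.supportDim A (M ⧸ (Ideal.ofList (xs ++ [x]) • ⊤ : Submodule A M)) = n := by
  rw [supportDim_quotient_ofList_concat]
  have hle := Module.supportDim_le_supportDim_quotSMulTop_succ
    (M := M ⧸ (Ideal.ofList xs • ⊤ : Submodule A M)) hx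
  rw [hn] at hle
  have : Nontrivial (M ⧸ (Ideal.ofList xs • ⊤ : Submodule A M)) := by
    rw [← Module.supportDim_ne_bot_iff_nontrivial A, hn]
    exact WithBot.coe_ne_bot
  have : Nontrivial (QuotSMulTop x (M ⧸ (Ideal.ofList xs • ⊤ : Submodule A M))) := by
    rw [← Module.supportDim_ne_bot_iff_nontrivial A]
    intro hbot
    rw [hbot, WithBot.bot_add] at hle
    exact absurd hle (not_le.2 (WithBot.bot_lt_coe _))
  obtain ⟨e, he⟩ := exists_supportDim_eq_natCast (A := A)
    (M := QuotSMulTop x (M ⧸ (Ideal.ofList xs • ⊤ : Submodule A M)))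
  rw [he] at hle hlt ⊢
  have h1 : n + 1 ≤ e + 1 := by exact_mod_cast hle
  have h2 : e < n + 1 := by exact_mod_cast hlt
  congr 2
  omega

/-- If `dim M > 0`, some `x` in the maximal ideal avoids all minimal primes of `M`. -/
theorem exists_mem_maximalIdeal_supportDim_quotSMulTop_lt {n : ℕ}
    (hn : Module.supportDim A M = (n + 1 : ℕ)) :
    ∃ x ∈ maximalIdeal A, Module.supportDim A (QuotSMulTop x M) < (n + 1 : ℕ) := by
  have hfin := (Module.annihilator A M).finite_minimalPrimes_of_isNoetherianRing
  have hnot : ¬ (maximalIdeal A : Set A) ⊆ ⋃ p ∈ (Module.annihilator A M).minimalPrimes, ↑p := by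
    intro hsub
    obtain ⟨p, hp, hmp⟩ := (Ideal.subset_union_prime_finite hfin (f := id) ⊥ ⊥
      fun p hp _ _ => hp.isPrime).1 (by simpa using hsub)
    have hsubs : Subsingleton (Module.support A M) := by
      have heq : ∀ q : Module.support A M, q.1.asIdeal = p := fun q => by
        have hqp : q.1.asIdeal ≤ p := (le_maximalIdeal q.1.2.ne_top).trans hmp
        exact le_antisymm hqp (hp.2 ⟨q.1.2, Module.mem_support_iff_of_finite.1 q.2⟩ hqp)
      exact ⟨fun q q' => Subtype.ext (PrimeSpectrum.ext ((heq q).trans (heq q').symm))⟩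
    have := Order.krullDim_nonpos_of_subsingleton (α := Module.support A M)
    rw [← Module.supportDim, hn] at this
    exact absurd (by exact_mod_cast this : n + 1 ≤ 0) (by omega)
  obtain ⟨x, hx, hxp⟩ := Set.not_subset.1 hnot
  refine ⟨x, hx, ?_⟩
  have hle := Module.supportDim_quotSMulTop_succ_le_of_notMem_minimalPrimes (M := M) (x := x)
    fun p hp hxp' => hxp (Set.mem_biUnion hp hxp')
  rw [hn] at hle
  by_contra! hge
  have : ((n + 1 + 1 : ℕ) : WithBot ℕ∞) ≤ (n + 1 : ℕ) :=
    le_trans (by push_cast; gcongr; exact_mod_cast hge) hle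
  exact absurd (by exact_mod_cast this : n + 1 + 1 ≤ n + 1) (by omega)

theorem isPartOfSystemOfParameters_of_supportDim_quotient {xs : List A} {n : ℕ}
    (hxs : ∀ x ∈ xs, x ∈ maximalIdeal A)
    (hn : Module.supportDim A (M ⧸ (Ideal.ofList xs • ⊤ : Submodule A M)) = n)
    (hd : Module.supportDim A M = (xs.length + n : ℕ)) :
    IsPartOfSystemOfParameters M xs := by
  induction n generalizing xs with
  | zero => exact ⟨[], by simpa using ⟨hxs, hd, isFiniteLength_of_supportDim_eq_zero hn⟩⟩
  | succ n ih =>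
    obtain ⟨x, hx, hlt⟩ := exists_mem_maximalIdeal_supportDim_quotSMulTop_lt hn
    obtain ⟨zs, hzs⟩ := ih (xs := xs ++ [x])
      (by simpa [or_imp, forall_and] using ⟨hxs, hx⟩)
      (supportDim_quotient_ofList_concat_eq hx hn hlt)
      (by rw [hd, List.length_append, List.length_singleton, add_assoc, add_comm 1])
    exact ⟨x :: zs, by simpa using hzs⟩

end Dimension

/-! ### Joint reductions -/

section JointReduction

variable {A : Type*} [CommRing A] {s : ℕ} {I : Fin s → Ideal A}
  {M : Type*} [AddCommGroup M] [Module A M]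

/-- Peeling off the elements of a superficial sequence one at a time, from the last to the first,
shows that `(y₁, …, y_k) M ∩ Iⁿ M` lies in the sum defining a joint reduction, for large `n`. -/
theorem IsReesSuperficialSequence.exists_ofList_smul_inf_le {ys : List A}
    (hys : IsReesSuperficialSequence I M ys) {k : ℕ} (hk : k ≤ ys.length) :
    ∃ N : ℕ, ∀ n : Fin s → ℕ, (∀ j, N ≤ n j) →
      (Ideal.ofList (ys.take k) • ⊤ : Submodule A M) ⊓ idealMonomial I (fun j => n j + 1) • ⊤ ≤
        ⨆ i : Fin s, Ideal.span ({y | y ∈ ys} ∩ (I i : Set A)) •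
          (idealMonomial I (Function.update (fun j => n j + 1) i (n i)) • (⊤ : Submodule A M)) := by
  induction k with
  | zero => exact ⟨0, fun n _ => by simp [Submodule.bot_smul]⟩
  | succ k ih =>
    obtain ⟨N, hN⟩ := ih (by omega)
    obtain ⟨i, hyi, N', hN'⟩ := hys k hk
    refine ⟨max N N', fun n hn u hu => ?_⟩
    obtain ⟨huJ, hun⟩ := hu
    set y := ys[k]
    set J := Ideal.ofList (ys.take k)
    set p := Function.update (fun j => n j + 1) i (n i)
    have hp : Function.update p i (p i + 1) = fun j => n j + 1 := by
      ext j
      rcases eq_or_ne j i with rfl | hj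
      · simp [p]
      · simp [p, hj]
    have hJ : Ideal.ofList (ys.take (k + 1)) = J ⊔ Ideal.span {y} := by
      rw [List.take_succ_eq_append_getElem (by omega), Ideal.ofList_append, Ideal.ofList_singleton]
    have hmap : ∀ K : Ideal A, (K • (⊤ : Submodule A M)).map (J • ⊤ : Submodule A M).mkQ = K • ⊤ :=
      fun K => by rw [Submodule.map_smul'', Submodule.map_top, Submodule.range_mkQ]
    have hmem : (J • ⊤ : Submodule A M).mkQ u ∈
        (Ideal.span {y} • (⊤ : Submodule A (M ⧸ (J • ⊤ : Submodule A M)))) ⊓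
          idealMonomial I (Function.update p i (p i + 1)) • ⊤ := by
      rw [← hmap, ← hmap, hp]
      refine ⟨?_, Submodule.mem_map_of_mem hun⟩
      rw [hJ, Submodule.sup_smul] at huJ
      rwa [SetLike.mem_coe, ← Submodule.mem_comap, Submodule.comap_map_mkQ]
    rw [hN' p (by simpa [p] using (le_max_right N N').trans (hn i)), ← hmap,
      ← Submodule.map_smul'', ← Submodule.mem_comap, Submodule.comap_map_mkQ] at hmem
    obtain ⟨w, hw, v, hv, rfl⟩ := Submodule.mem_sup.1 hmem
    have hvn : v ∈ idealMonomial I (fun j => n j + 1) • (⊤ : Submodule A M) := by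
      rw [← hp, idealMonomial_update_add_one, Submodule.mul_smul]
      exact Submodule.smul_mono_left ((Ideal.span_singleton_le_iff_mem _).2 hyi) hv
    refine add_mem (hN n (fun j => (le_max_left N N').trans (hn j)) ⟨hw, ?_⟩) ?_
    · exact (Submodule.add_mem_iff_left _ hvn).1 hun
    · refine (le_iSup (fun i : Fin s => Ideal.span ({y | y ∈ ys} ∩ (I i : Set A)) •
        (idealMonomial I (Function.update (fun j => n j + 1) i (n i)) • (⊤ : Submodule A M))) i) ?_
      refine Submodule.smul_mono_left (Ideal.span_mono ?_) hv
      exact Set.singleton_subset_iff.2 ⟨ys.getElem_mem hk, hyi⟩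

/-- The radical condition gives `I₁ ^ n₁ ⋯ I_s ^ n_s M ⊆ (y₁, …, y_m) M` for large `n`, so that the
intersection in `IsReesSuperficialSequence.exists_ofList_smul_inf_le` is the whole module. -/
theorem IsReesSuperficialSequence.isJointReduction [IsNoetherianRing A] {ys : List A}
    (hys : IsReesSuperficialSequence I M ys)
    (hrad : ∏ j, I j ≤ (Ideal.ofList ys ⊔ Module.annihilator A M).radical) :
    IsJointReduction I M {y | y ∈ ys} := by
  refine ⟨ys.finite_toSet, fun y hy => ?_, ?_⟩
  · obtain ⟨k, hk, rfl⟩ := List.getElem_of_mem hy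
    obtain ⟨i, hi, -⟩ := hys k hk
    exact ⟨i, hi⟩
  obtain ⟨N, hN⟩ := hys.exists_ofList_smul_inf_le (le_refl ys.length)
  obtain ⟨k, hk⟩ := Ideal.exists_pow_le_of_le_radical_of_fg hrad (IsNoetherian.noetherian _)
  refine ⟨max N k, fun n hn => le_antisymm ?_ (iSup_le fun i => ?_)⟩
  · refine le_trans (le_inf ?_ le_rfl) (hN n fun j => (le_max_left N k).trans (hn j))
    have hle : idealMonomial I (fun j => n j + 1) ≤ (∏ j, I j) ^ k := by
      rw [← Finset.prod_pow]
      exact idealMonomial_antitone I (m := fun _ => k) fun j =>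
        ((le_max_right N k).trans (hn j)).trans (Nat.le_succ _)
    refine (Submodule.smul_mono_left (hle.trans hk)).trans ?_
    rw [List.take_length, Submodule.sup_smul]
    refine sup_le le_rfl (Submodule.smul_le.2 fun a ha m _ => ?_)
    rw [Module.mem_annihilator.1 ha m]
    exact zero_mem _
  · have hp : (fun j => n j + 1) = Function.update (Function.update (fun j => n j + 1) i (n i)) i
        ((Function.update (fun j => n j + 1) i (n i)) i + 1) := by
      ext j
      rcases eq_or_ne j i with rfl | hj
      · simp
      · simp [hj]
    conv_rhs => rw [hp, idealMonomial_update_add_one, Submodule.mul_smul]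
    exact Submodule.smul_mono_left (Ideal.span_le.2 Set.inter_subset_right)

theorem IsReesSuperficialSequence.concat {xs : List A} (hxs : IsReesSuperficialSequence I M xs)
    {x : A} (hx : IsReesSuperficialElement I (M ⧸ (Ideal.ofList xs • ⊤ : Submodule A M)) x) :
    IsReesSuperficialSequence I M (xs ++ [x]) := by
  intro k hk
  rcases Nat.lt_or_ge k xs.length with h | h
  · rw [List.take_append_of_le_length h.le, List.getElem_append_left h]
    exact hxs k h
  · obtain rfl : k = xs.length := by simp at hk; omega
    rw [List.take_left, List.getElem_concat_length rfl]
    exact hx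

end JointReduction

/-! ### Superficial systems of parameters -/

section Existence

open IsLocalRing

variable {A : Type*} [CommRing A] [IsLocalRing A] {M : Type*} [AddCommGroup M] [Module A M]

theorem map_sup_annihilator_ne_top [Nontrivial M] {K : Ideal A} (hK : K ≠ ⊤) :
    (K ⊔ Module.annihilator A M).map (Ideal.Quotient.mk (Module.annihilator A M)) ≠ ⊤ := by
  have hann : Module.annihilator A M ≠ ⊤ := fun h => by
    obtain ⟨m, hm⟩ := exists_ne (0 : M)
    exact hm (by simpa using Module.mem_annihilator.1 (h ▸ Submodule.mem_top : (1 : A) ∈ _) m)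
  have hle : K ⊔ Module.annihilator A M ≤ maximalIdeal A :=
    sup_le (le_maximalIdeal hK) (le_maximalIdeal hann)
  intro h
  refine (maximalIdeal.isMaximal A).ne_top (top_le_iff.1 (le_trans ?_ hle))
  have := congrArg (Ideal.comap (Ideal.Quotient.mk (Module.annihilator A M))) h
  rw [Ideal.comap_map_of_surjective _ Ideal.Quotient.mk_surjective, Ideal.comap_top,
    ← RingHom.ker_eq_comap_bot, Ideal.mk_ker, sup_assoc, sup_idem] at this
  exact this.ge

/-- Superficial elements chosen in an ideal `I_i` of height at least `t` modulo `Ann M` are the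
first `t` elements of a system of parameters. -/
theorem exists_isReesSuperficialSequence_supportDim [IsNoetherianRing A]
    [Module.Finite A M] [Infinite (ResidueField A)] {s : ℕ}
    {I : Fin s → Ideal A} {i : Fin s} (hi : I i ≠ ⊤) {d t : ℕ} (hd : Module.supportDim A M = d)
    (ht : (t : ℕ∞) ≤ ((I i ⊔ Module.annihilator A M).map
      (Ideal.Quotient.mk (Module.annihilator A M))).height) (htd : t ≤ d) :
    ∃ xs : List A, xs.length = t ∧ IsReesSuperficialSequence I M xs ∧
      (∀ x ∈ xs, x ∈ maximalIdeal A) ∧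
      Module.supportDim A (M ⧸ (Ideal.ofList xs • ⊤ : Submodule A M)) = (d - t : ℕ) := by
  induction t with
  | zero =>
    refine ⟨[], rfl, fun k hk => absurd hk (by simp), by simp, ?_⟩
    rw [Module.supportDim, Module.support_quotient, Ideal.ofList_nil, Submodule.bot_coe,
      PrimeSpectrum.zeroLocus_singleton_zero, Set.inter_univ, Nat.sub_zero]
    exact hd
  | succ t ih =>
    obtain ⟨xs, hlen, hxs, hmem, hdim⟩ := ih (le_trans (by norm_cast; omega) ht) (by omega)
    obtain ⟨x, hxi, hx, hxp⟩ := exists_isReesSuperficialElement I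
      (M ⧸ (Ideal.ofList xs • ⊤ : Submodule A M)) i
      ((Module.annihilator A
        (M ⧸ (Ideal.ofList xs • ⊤ : Submodule A M))).finite_minimalPrimes_of_isNoetherianRing)
    have hxm := le_maximalIdeal hi hxi
    obtain ⟨e, he⟩ : ∃ e, d - t = e + 1 := ⟨d - t - 1, by omega⟩
    rw [he] at hdim
    refine ⟨xs ++ [x], by simp [hlen], hxs.concat hx,
      by simpa [or_imp, forall_and] using ⟨hmem, hxm⟩, ?_⟩
    rw [show d - (t + 1) = e by omega]
    refine supportDim_quotient_ofList_concat_eq hxm hdim (supportDim_quotSMulTop_lt (M := M)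
      (by rw [Module.support_quotient]; exact Set.inter_subset_left) hdim (K := I i) ?_ hxp)
    rw [hd]
    refine WithBot.coe_lt_coe.2 (lt_of_lt_of_le ?_ (add_le_add_left ht _))
    norm_cast
    omega

end Existence

theorem proposition2p4 {A : Type*} [CommRing A] [IsNoetherianRing A] [IsLocalRing A]
    [Infinite (IsLocalRing.ResidueField A)]
    {M : Type*} [AddCommGroup M] [Module A M] [Module.Finite A M]
    (hd : 0 < Module.supportDim A M)
    {s : ℕ} (hs : 0 < s) (I : Fin s → Ideal A) :
    ((∀ j, I j ≠ ⊤) →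
      ∃ h : ℕ,
        IsGreatest
          (Set.range fun j : Fin s =>
            ((I j ⊔ Module.annihilator A M).map
              (Ideal.Quotient.mk (Module.annihilator A M))).height) (h : ℕ∞) ∧
        ∃ xs : List A, xs.length = h ∧ IsReesSuperficialSequence I M xs ∧
          IsPartOfSystemOfParameters M xs) ∧
    (∀ ys : List A, IsReesSuperficialSequence I M ys →
      (∏ j, I j ≤ (Ideal.ofList ys ⊔ Module.annihilator A M).radical →
        IsJointReduction I M {y | y ∈ ys}) ∧
      ((∀ j, I j ≠ ⊤) → IsSystemOfParameters M ys →
        ∏ j, I j ≤ (Ideal.ofList ys ⊔ Module.annihilator A M).radical ∧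
        IsJointReduction I M {y | y ∈ ys})) := by
  have hM : Nontrivial M := by
    rw [← Module.supportDim_ne_bot_iff_nontrivial A]
    exact (bot_lt_iff_ne_bot.1 (lt_of_le_of_lt bot_le hd))
  refine ⟨fun hI => ?_, fun ys hys => ⟨hys.isJointReduction, fun hI hsop => ?_⟩⟩
  · have : Nonempty (Fin s) := ⟨⟨0, hs⟩⟩
    obtain ⟨i, hmax⟩ := Finite.exists_max fun j : Fin s =>
      ((I j ⊔ Module.annihilator A M).map
        (Ideal.Quotient.mk (Module.annihilator A M))).height
    have htop := map_sup_annihilator_ne_top (M := M) (hI i)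
    obtain ⟨h, hh⟩ := ENat.ne_top_iff_exists.1 (Ideal.height_ne_top htop)
    obtain ⟨d, hdim⟩ := exists_supportDim_eq_natCast (A := A) (M := M)
    have hle : h ≤ d := by
      have := Ideal.height_le_ringKrullDim_of_ne_top htop
      rw [← Module.supportDim_eq_ringKrullDim_quotient_annihilator, hdim, ← hh] at this
      exact_mod_cast this
    refine ⟨h, ⟨⟨i, hh.symm⟩, ?_⟩, ?_⟩
    · rintro _ ⟨j, rfl⟩
      exact hh ▸ hmax j
    obtain ⟨xs, hlen, hxs, hmem, hxd⟩ :=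
      exists_isReesSuperficialSequence_supportDim (hI i) hdim hh.le hle
    exact ⟨xs, hlen, hxs, isPartOfSystemOfParameters_of_supportDim_quotient hmem hxd
      (by rw [hdim, hlen, Nat.add_sub_cancel' hle])⟩
  · have hle : ∏ j, I j ≤ (Ideal.ofList ys ⊔ Module.annihilator A M).radical :=
      (Ideal.prod_le_inf.trans (Finset.inf_le (Finset.mem_univ ⟨0, hs⟩))).trans
        ((IsLocalRing.le_maximalIdeal (hI _)).trans
          (maximalIdeal_le_radical_of_isFiniteLength hsop.2.2))
    exact ⟨hle, hys.isJointReduction hle⟩
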